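/- For a non-singular real $2\times 2$ matrix $M$ let $\mathbb{T}_M=\mathbb{R}^2/M\mathbb{Z}^2$, and let $\mathbb{T}_\square=\mathbb{T}_I$ be the square flat torus; the linear map $x\mapsto Mx$ carries each drawing on $\mathbb{T}_\square$ to its image on $\mathbb{T}_M$. Let $G$ be a finite connected graph (loops and parallel edges allowed) with a cellular embedding on $\mathbb{T}_\square$, and consider a geodesic drawing of $G$ on $\mathbb{T}_\square$ (each edge is the projection of a line segment; crossings and coincidences are allowed) that is homotopic to this embedding. For each edge $e$, with a fixed reference direction, let $(\Delta x_e,\Delta y_e)$ be the displacement vector of a lift of $e$ to $\mathbb{R}^2$, and let $\Delta$ be the $2\times E$ matrix with these columns. Let $\omega\in\mathbb{R}^E$ be an equilibrium stress, that is, at every vertex $p$ the sum of $\omega_e$ times the displacement vector over all directed edges leaving $p$ is $0$; the $\omega_e$ need not be positive. Let $\Omega$ be the diagonal matrix of $\omega$ and put $$\alpha=\sum_e\omega_e\,\Delta x_e^2,\qquad \beta=\sum_e\omega_e\,\Delta y_e^2,\qquad \gamma=\sum_e\omega_e\,\Delta x_e\Delta y_e,$$ so that $\Delta\Omega\Delta^T=\begin{pmatrix}\alpha&\gamma\\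 \gamma&\beta\end{pmatrix}$. The dual graph $G^*$ has the faces of the embedding as its vertices, and the dual $e^*$ of a directed edge $e$ is directed from the face to the right of $e$ to the face to the left of $e$, where left and right refer to the embedding on $\mathbb{T}_\square$. In the natural embedding of $G^*$ on $\mathbb{T}_\square$, each vertex $f^*$ lies inside the face $f$ and each edge $e^*$ crosses only $e$. We say that $\omega$ is an orthogonal reciprocal stress for the image of $G$ on $\mathbb{T}_M$ if there is a geodesic drawing of $G^*$ on $\mathbb{T}_M$ (not necessarily an embedding), homotopic to the image of the natural embedding of $G^*$, such that for every edge $e$ of $G$ the edge $e^*$ is orthogonal to $e$ and $\omega_e=|e^*|/|e|$, where the length $|e^*|$ is signed: positive if $e^*$ points in the direction of the counterclockwise quarter turn of $e$ in $\mathbb{R}^2$, and negative if it points in the opposite direction. (Equivalently, the displacement vector of $e^*$ is $\omega_e$ times the counterclockwise quarter turn of the displacement vector of $e$ on $\mathbb{T}_M$.) (a) If $\alpha\beta-\gamma^2=1$, then $M$ is non-singular and $\omega$ is an orthogonal reciprocal stress for the image of $G$ on $\mathbb{T}_M$ if and only if $M=\sigma R\begin{pmatrix}\beta&-\gamma\\0&1\end{pmatrix}$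 for some rotation matrix $R$ and some real number $\sigma>0$. (b) If $\alpha\beta-\gamma^2\neq1$, then $\omega$ is not an orthogonal reciprocal stress for the image of $G$ on $\mathbb{T}_M$ for any non-singular $M$. -/

import Mathlib

open scoped Matrix

/-- A finite graph with vertex type `V` and edge type `E`; loops and parallel edges are allowed.
Every edge has an arbitrarily chosen reference direction, from `src e` to `tgt e`. -/
structure MultiGraph (V E : Type*) where
  src : E → V
  tgt : E → V

/-- Each edge `e` consists of two opposite darts: the reference dart `(e, true)` and its
reversal `(e, false)`. -/
abbrev Dart (E : Type*) := E × Bool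

/-- Reversal of darts, as a permutation. -/
def revDart (E : Type*) : Equiv.Perm (Dart E) where
  toFun d := (d.1, !d.2)
  invFun d := (d.1, !d.2)
  left_inv d := by simp
  right_inv d := by simp

/-- The antisymmetric extension to all darts of a function given on the reference darts. -/
def onDarts {E A : Type*} [Neg A] (x : E → A) (d : Dart E) : A :=
  if d.2 then x d.1 else -x d.1

/-- The determinant of the matrix with columns `v`, `w`. -/
def cross {R : Type*} [Ring R] (v w : Fin 2 → R) : R := v 0 * w 1 - v 1 * w 0

/-- The Euclidean length of a plane vector. -/
noncomputable def euclideanLength (v : Fin 2 → ℝ) : ℝ := Real.sqrt (v ⬝ᵥ v)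

namespace MultiGraph

variable {V E : Type*}

/-- The vertex from which a dart leaves. -/
def tail (Γ : MultiGraph V E) (d : Dart E) : V := if d.2 then Γ.src d.1 else Γ.tgt d.1

/-- The vertex at which a dart arrives. -/
def head (Γ : MultiGraph V E) (d : Dart E) : V := Γ.tail (revDart E d)

/-- `l` is the sequence of darts of a walk from `u` to `v`. -/
def IsWalk (Γ : MultiGraph V E) : V → V → List (Dart E) → Prop
  | u, v, [] => u = v
  | u, v, d :: l => Γ.tail d = u ∧ Γ.IsWalk (Γ.head d) v l

/-- Every two vertices are joined by a walk, and there is a vertex. -/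
def IsConnected (Γ : MultiGraph V E) : Prop := Nonempty V ∧ ∀ u v, ∃ l, Γ.IsWalk u v l

/-- Two drawings of the same graph on the same torus, with homology vectors `h` and `h'` on the
reference darts, are homotopic iff every closed walk has the same homology class in both.
(The fundamental group of the torus is abelian and its universal cover is contractible.) -/
def Homotopic (Γ : MultiGraph V E) (h h' : E → Fin 2 → ℤ) : Prop :=
  ∀ (v : V) (l : List (Dart E)), Γ.IsWalk v v l →
    (l.map (onDarts h)).sum = (l.map (onDarts h')).sum

end MultiGraph

/-- A rotation system: `rot` sends each dart to the counterclockwise next dart with the same tail.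
Cellular embeddings of a connected graph in closed oriented surfaces are, up to orientation
preserving homeomorphism, the same as rotation systems. -/
structure RotationSystem {V E : Type*} (Γ : MultiGraph V E) where
  rot : Equiv.Perm (Dart E)
  tail_rot : ∀ d, Γ.tail (rot d) = Γ.tail d
  rot_sameCycle : ∀ d d', Γ.tail d = Γ.tail d' → rot.SameCycle d d'

namespace RotationSystem

variable {V E : Type*} {Γ : MultiGraph V E}

/-- The dart that follows `d` on the counterclockwise boundary walk of the face to the left of `d`:
at the head of `d`, it is the clockwise next dart after the reversal of `d`. -/
def faceNext (K : RotationSystem Γ) : Equiv.Perm (Dart E) := (revDart E).trans K.rot.symm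

/-- The faces are the orbits of `faceNext`. -/
def Face (K : RotationSystem Γ) : Type _ := Quotient (Equiv.Perm.SameCycle.setoid K.faceNext)

/-- The face to the left of a dart. -/
def left (K : RotationSystem Γ) (d : Dart E) : K.Face := Quotient.mk _ d

/-- The face to the right of a dart. -/
def right (K : RotationSystem Γ) (d : Dart E) : K.Face := K.left (revDart E d)

/-- The dual graph: its vertices are the faces, its edges are the edges of `Γ`, and the dual of a
dart `d` leads from the face to the right of `d` to the face to the left of `d`. -/
def dual (K : RotationSystem Γ) : MultiGraph K.Face E where
  src e := K.right (e, true)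
  tgt e := K.left (e, true)

end RotationSystem

/-- A cellular embedding of `Γ` on the square flat torus `ℝ² / ℤ²`, up to isotopy: a rotation system
of a surface of Euler characteristic `0`, together with the homology vectors which the embedding
gives to the edges of `Γ` and to arcs inside the faces.

Choose a centre `f*` in each face `f`. For a dart `d` with left face `f`, `corner d` is the homology
vector of an arc inside `f` from `f*` to the corner of `f` at the tail of `d`; so `corner d` is also
the place of the tail of `d` in a lift to the plane of the face `f` with its centre at the origin,
when all vertices are moved to the origin of the torus. The arcs cut the face into triangles
`f*, tail d, head d`, which are contractible (`corner_faceNext`).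

A system of such homology vectors is a homotopy class of maps from the surface to the torus. It
is the class of an orientation preserving homeomorphism iff its degree is one. The degree is the
sum of the signed areas of the lifted faces, divided by the area `1` of the torus (`degree_one`,
where both sides are doubled). -/
structure TorusEmbedding {V E : Type*} [Fintype V] [Fintype E] (Γ : MultiGraph V E) extends
    RotationSystem Γ where
  connected : Γ.IsConnected
  euler : (Nat.card V : ℤ) - Nat.card E + Nat.card toRotationSystem.Face = 0
  hom : E → Fin 2 → ℤ
  corner : Dart E → Fin 2 → ℤ
  corner_faceNext : ∀ d, corner (toRotationSystem.faceNext d) = corner d + onDarts hom d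
  degree_one : ∑ d, cross (corner d) (corner (toRotationSystem.faceNext d)) = 2

/-- The homology vectors of the natural embedding of the dual graph, in which each dual vertex `f*`
is the centre of `f` and each dual edge `e*` crosses only `e`. The dual of the dart `d = (e, true)`
can be deformed to the path from the centre of the right face to the head of `d`, then back along
`d` to its tail, and then to the centre of the left face. -/
def TorusEmbedding.dualHom {V E : Type*} [Fintype V] [Fintype E] {Γ : MultiGraph V E}
    (K : TorusEmbedding Γ) (e : E) : Fin 2 → ℤ :=
  K.corner (e, false) - K.hom e - K.corner (e, true)

/-- A geodesic drawing of `Γ` on the flat torus `ℝ² / Mℤ²`: each vertex `v` is drawn at the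
projection of `pos v`, and each edge `e` is drawn as the projection of the line segment from
`pos (src e)` to `pos (tgt e) + M (hom e)`. There is no injectivity requirement. -/
structure GeodesicDrawing {V E : Type*} (Γ : MultiGraph V E) (M : Matrix (Fin 2) (Fin 2) ℝ) where
  pos : V → Fin 2 → ℝ
  hom : E → Fin 2 → ℤ

namespace GeodesicDrawing

variable {V E : Type*} {Γ : MultiGraph V E} {M : Matrix (Fin 2) (Fin 2) ℝ}

/-- The displacement vector of (the reference dart of) an edge. -/
def disp (G : GeodesicDrawing Γ M) (e : E) : Fin 2 → ℝ :=
  G.pos (Γ.tgt e) - G.pos (Γ.src e) + M *ᵥ (fun i => (G.hom e i : ℝ))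

/-- The displacement matrix: its columns are the displacement vectors of the reference darts. -/
def dispMatrix (G : GeodesicDrawing Γ M) : Matrix (Fin 2) E ℝ := Matrix.of fun i e => G.disp e i

/-- The image on `ℝ² / Mℤ²` of a drawing on the square flat torus, under the linear
map `x ↦ M x`. -/
def image (G : GeodesicDrawing Γ 1) (M : Matrix (Fin 2) (Fin 2) ℝ) : GeodesicDrawing Γ M where
  pos v := M *ᵥ G.pos v
  hom := G.hom

/-- The drawing is homotopic to (the image on `ℝ² / Mℤ²` of) the embedding `K`. -/
def HomotopicTo [Fintype V] [Fintype E] (G : GeodesicDrawing Γ M) (K : TorusEmbedding Γ) : Prop :=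
  Γ.Homotopic G.hom K.hom

open Classical in
/-- At every vertex `p`, the stressed displacement vectors of the darts leaving `p` add up to zero.
The stresses can be arbitrary real numbers. -/
def IsEquilibriumStress [Fintype E] (G : GeodesicDrawing Γ M) (ω : E → ℝ) : Prop :=
  ∀ p : V, ∑ d : Dart E, (if Γ.tail d = p then ω d.1 • onDarts G.disp d else 0) = 0

/-- A geodesic drawing `G'` of the dual graph of `K`, on the same flat torus as `G`, is an
orthogonal reciprocal drawing with respect to `K`: it is homotopic to the natural embedding of the
dual graph, and each edge is orthogonal to its dual edge. -/
def IsOrthogonalReciprocal [Fintype V] [Fintype E] (G : GeodesicDrawing Γ M)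
    (K : TorusEmbedding Γ) (G' : GeodesicDrawing K.dual M) : Prop :=
  K.dual.Homotopic G'.hom K.dualHom ∧ ∀ e, G.disp e ⬝ᵥ G'.disp e = 0

/-- `ω` is an orthogonal reciprocal stress for `G`: an equilibrium stress for which there is an
orthogonal reciprocal drawing of the dual graph such that `ω e = |e*| / |e|` for each edge. The
length `|e*|` is signed: it counts as positive if `e*` points in the direction of the
counterclockwise quarter turn of `e`, and as negative if it points in the opposite direction. -/
def IsOrthogonalReciprocalStress [Fintype V] [Fintype E] (G : GeodesicDrawing Γ M)
    (K : TorusEmbedding Γ) (ω : E → ℝ) : Prop :=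
  G.IsEquilibriumStress ω ∧
    ∃ G' : GeodesicDrawing K.dual M, G.IsOrthogonalReciprocal K G' ∧
      ∀ e, euclideanLength (G'.disp e) = |ω e| * euclideanLength (G.disp e) ∧
        0 ≤ ω e * cross (G.disp e) (G'.disp e)

end GeodesicDrawing

/-! Let `J` be the quarter turn and `S = Δ Ω Δᵀ`. The displacement of `e*` is forced to be `ω e • J
M (disp e)`, so the only question is whether these vectors come from a drawing of the dual graph in
the right homotopy class. They do iff the cochain `ω e • J M (disp e) - M (dualHom e)` is a
coboundary of the dual graph. By `exists_dual_potential`, this means that it is orthogonal to all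
coboundaries of the primal graph and to the two coordinates of `hom`. The first condition is
automatic: equilibrium handles the first term, and closedness of `dualHom` around vertices handles
the second. For the second condition, `disp` and `hom` differ by a coboundary, which equilibrium
kills, so the pairing of `ω • disp` with `hom` is `S` (`sum_disp_mul_hom`). The pairing of `dualHom`
with `hom` is the intersection form `J` (`sum_dualHom_mul_hom`). What remains is the equation `J M S
= M J`. Determinants then force `det S = 1`. When this holds, the solutions are `(a I + b J) !![β,
-γ; 0, 1]`, and the nonzero matrices `a I + b J` are exactly the scaled rotations. -/

section Darts

variable {V E : Type*}

theorem onDarts_rev {A : Type*} [AddGroup A] (x : E → A) (d : Dart E) :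
    onDarts x (revDart E d) = -onDarts x d := by
  rcases d with ⟨e, _ | _⟩ <;> simp [onDarts, revDart]

theorem sum_darts {A : Type*} [AddCommMonoid A] [Fintype E] (F : Dart E → A) :
    ∑ d, F d = ∑ e, (F (e, true) + F (e, false)) := by
  simp [Fintype.sum_prod_type]

theorem sum_onDarts_mul_onDarts [Fintype E] (x y : E → ℝ) :
    ∑ d, onDarts x d * onDarts y d = 2 * ∑ e, x e * y e := by
  rw [sum_darts, Finset.mul_sum]
  refine Finset.sum_congr rfl fun e _ => ?_
  simp [onDarts]; ring

theorem onDarts_comp {A B : Type*} [AddGroup A] [AddGroup B] (f : A →+ B) (x : E → A)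
    (d : Dart E) : onDarts (fun e => f (x e)) d = f (onDarts x d) := by
  rcases d with ⟨e, _ | _⟩ <;> simp [onDarts]

end Darts

/-! ### Walks, potentials and summation by parts on a graph. -/

namespace MultiGraph

variable {V E : Type*} (Γ : MultiGraph V E)

theorem sum_coboundary_mul [Fintype E] (q : V → ℝ) (φ : E → ℝ) :
    ∑ e, (q (Γ.tgt e) - q (Γ.src e)) * φ e = -∑ d, q (Γ.tail d) * onDarts φ d := by
  rw [sum_darts, ← Finset.sum_neg_distrib]
  refine Finset.sum_congr rfl fun e _ => ?_
  simp [onDarts, tail]; ring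

variable {Γ}

theorem IsWalk.append {u v w : V} {l l' : List (Dart E)} (h : Γ.IsWalk u v l)
    (h' : Γ.IsWalk v w l') : Γ.IsWalk u w (l ++ l') := by
  induction l generalizing u with
  | nil => cases h; exact h'
  | cons d l ih => exact ⟨h.1, ih h.2⟩

theorem isWalk_singleton (d : Dart E) : Γ.IsWalk (Γ.tail d) (Γ.head d) [d] := ⟨rfl, rfl⟩

theorem tail_rev (d : Dart E) : Γ.tail (revDart E d) = Γ.head d := rfl

theorem head_rev (d : Dart E) : Γ.head (revDart E d) = Γ.tail d := by
  rcases d with ⟨e, b⟩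
  simp [head, revDart]

theorem IsWalk.exists_reverse {A : Type*} [AddCommGroup A] (x : E → A) {u v : V}
    {l : List (Dart E)} (h : Γ.IsWalk u v l) :
    ∃ l', Γ.IsWalk v u l' ∧ (l'.map (onDarts x)).sum = -(l.map (onDarts x)).sum := by
  induction l generalizing u with
  | nil => cases h; exact ⟨[], rfl, by simp⟩
  | cons d l ih =>
    obtain ⟨l', hl', hs⟩ := ih h.2
    refine ⟨l' ++ [revDart E d], hl'.append ?_, ?_⟩
    · have := isWalk_singleton (Γ := Γ) (revDart E d)
      rwa [tail_rev, head_rev, h.1] at this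
    · simp [hs, onDarts_rev]

/-- A cochain that vanishes on all closed walks is a coboundary. -/
theorem exists_potential {A : Type*} [AddCommGroup A] (x : E → A)
    (hx : ∀ (v : V) (l : List (Dart E)), Γ.IsWalk v v l → (l.map (onDarts x)).sum = 0) :
    ∃ q : V → A, ∀ e, x e = q (Γ.tgt e) - q (Γ.src e) := by
  -- The potential is the sum along a walk from a chosen root of each connected component, so
  -- connectedness is not needed.
  let s : Setoid V :=
    { r := fun u v => ∃ l, Γ.IsWalk u v l
      iseqv :=
        { refl := fun u => ⟨[], rfl⟩
          symm := fun ⟨_, hl⟩ => let ⟨l', hl', _⟩ := hl.exists_reverse x; ⟨l', hl'⟩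
          trans := fun ⟨_, hl⟩ ⟨_, hl'⟩ => ⟨_, hl.append hl'⟩ } }
  have hroot : ∀ v, ∃ l, Γ.IsWalk (Quotient.mk s v).out v l := fun v => Quotient.mk_out (s := s) v
  choose w hw using hroot
  refine ⟨fun v => ((w v).map (onDarts x)).sum, fun e => ?_⟩
  have he := isWalk_singleton (Γ := Γ) (e, true)
  have hq : Quotient.mk s (Γ.src e) = Quotient.mk s (Γ.tgt e) := Quotient.sound ⟨_, he⟩
  have h1 := hw (Γ.src e)
  obtain ⟨l, hl, hs⟩ := (hw (Γ.tgt e)).exists_reverse x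
  rw [hq] at h1
  have := hx _ _ ((h1.append he).append hl)
  simp only [List.map_append, List.sum_append, hs] at this
  have h2 : (List.map (onDarts x) [((e, true) : Dart E)]).sum = x e := by simp [onDarts]
  rw [h2] at this
  rw [eq_sub_iff_add_eq, add_comm]
  exact add_neg_eq_zero.1 this

theorem Homotopic.exists_potential {h h' : E → Fin 2 → ℤ} (H : Γ.Homotopic h h') :
    ∃ q : V → Fin 2 → ℤ, ∀ e, h e = h' e + (q (Γ.tgt e) - q (Γ.src e)) := by
  obtain ⟨q, hq⟩ := MultiGraph.exists_potential (Γ := Γ) (fun e => h e - h' e) (fun v l hl => by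
    have : onDarts (fun e => h e - h' e) = fun d => onDarts h d - onDarts h' d := by
      funext d
      rcases d with ⟨e, _ | _⟩
      · simp [onDarts]; abel
      · simp [onDarts]
    have hsum : ∀ l : List (Dart E), (l.map fun d => onDarts h d - onDarts h' d).sum
        = (l.map (onDarts h)).sum - (l.map (onDarts h')).sum := fun l => by
      induction l with
      | nil => simp
      | cons d l ih => simp only [List.map_cons, List.sum_cons, ih]; abel
    rw [this, hsum, H v l hl, sub_self])
  exact ⟨q, fun e => by rw [← hq e]; abel⟩

/-- Functions on the vertices of a connected graph with zero coboundary are constant. -/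
theorem IsConnected.eq_of_coboundary_eq_zero {A : Type*} (hΓ : Γ.IsConnected) (q : V → A)
    (hq : ∀ e, q (Γ.tgt e) = q (Γ.src e)) (u v : V) : q u = q v := by
  have hd : ∀ d, q (Γ.head d) = q (Γ.tail d) := by
    rintro ⟨e, _ | _⟩ <;> simp [head, tail, revDart, hq]
  obtain ⟨l, hl⟩ := hΓ.2 u v
  induction l generalizing u with
  | nil => cases hl; rfl
  | cons d l ih => rw [← hl.1, ← hd, ih _ hl.2]

end MultiGraph

/-! ### Coboundaries on the dual graph. -/

namespace RotationSystem

variable {V E : Type*} {Γ : MultiGraph V E} (K : RotationSystem Γ)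

theorem left_faceNext (d : Dart E) : K.left (K.faceNext d) = K.left d :=
  Quotient.sound (s := Equiv.Perm.SameCycle.setoid K.faceNext)
    (Equiv.Perm.sameCycle_apply_left.2 (Equiv.Perm.SameCycle.refl _ _))

theorem tail_rot_symm (d : Dart E) : Γ.tail (K.rot.symm d) = Γ.tail d := by
  rw [← K.tail_rot, Equiv.apply_symm_apply]

theorem tail_faceNext (d : Dart E) : Γ.tail (K.faceNext d) = Γ.head d :=
  K.tail_rot_symm _

theorem faceNext_rev (d : Dart E) : K.faceNext (revDart E d) = K.rot.symm d := by
  rcases d with ⟨e, b⟩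
  simp [faceNext, revDart]

theorem sum_dual_coboundary_mul [Fintype E] (p : K.Face → ℝ) (φ : E → ℝ) :
    ∑ e, (p (K.left (e, true)) - p (K.right (e, true))) * φ e
      = ∑ d, p (K.left d) * onDarts φ d := by
  rw [sum_darts]
  refine Finset.sum_congr rfl fun e _ => ?_
  simp [onDarts, right, revDart]; ring

/-- Coboundaries on the dual graph are orthogonal to cochains that are closed on each face. -/
theorem sum_dual_coboundary_mul_eq_zero [Fintype E] (p : K.Face → ℝ) (φ : E → ℝ)
    (c : Dart E → ℝ) (hc : ∀ d, c (K.faceNext d) = c d + onDarts φ d) :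
    ∑ e, (p (K.left (e, true)) - p (K.right (e, true))) * φ e = 0 := by
  rw [sum_dual_coboundary_mul]
  -- Since `p` is constant along a face boundary, the sum telescopes around each face.
  have h1 : ∀ d, p (K.left d) * onDarts φ d
      = p (K.left (K.faceNext d)) * c (K.faceNext d) - p (K.left d) * c d := fun d => by
    rw [left_faceNext, hc]; ring
  rw [Finset.sum_congr rfl fun d _ => h1 d, Finset.sum_sub_distrib,
    Equiv.sum_comp K.faceNext (fun d => p (K.left d) * c d), sub_self]

theorem sum_dual_coboundary_mul_coboundary [Fintype E] (p : K.Face → ℝ) (q : V → ℝ) :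
    ∑ e, (p (K.left (e, true)) - p (K.right (e, true))) * (q (Γ.tgt e) - q (Γ.src e)) = 0 := by
  refine K.sum_dual_coboundary_mul_eq_zero p _ (fun d => q (Γ.tail d)) fun d => ?_
  rw [tail_faceNext]
  rcases d with ⟨e, _ | _⟩ <;> simp [onDarts, MultiGraph.head, MultiGraph.tail, revDart]

/-- The dual of a connected graph is connected. -/
theorem eq_of_dual_coboundary_eq_zero {A : Type*} (hΓ : Γ.IsConnected) (p : K.Face → A)
    (hp : ∀ e, p (K.left (e, true)) = p (K.right (e, true))) (f g : K.Face) : p f = p g := by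
  have hrev : ∀ d, p (K.left (revDart E d)) = p (K.left d) := by
    rintro ⟨e, _ | _⟩
    · exact hp e
    · exact (hp e).symm
  -- The face to the right of `K.rot d` is the face to the left of `d`, so turning about a vertex
  -- crosses one edge at a time.
  have hrot : ∀ d, p (K.left (K.rot d)) = p (K.left d) := fun d => by
    rw [← hrev (K.rot d), ← K.left_faceNext, faceNext_rev, Equiv.symm_apply_apply]
  have hcyc : ∀ d d', K.rot.SameCycle d d' → p (K.left d) = p (K.left d') := by
    rintro d d' ⟨i, rfl⟩
    induction i with
    | zero => rfl
    | succ i ih => rw [ih, add_comm, zpow_add, zpow_one, Equiv.Perm.mul_apply, hrot]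
    | pred i ih =>
      rw [ih, ← hrot ((K.rot ^ (-(i : ℤ) - 1)) d), ← Equiv.Perm.mul_apply, ← zpow_one_add]
      congr 4; ring
  have hwalk : ∀ (l : List (Dart E)) (d d' : Dart E), Γ.IsWalk (Γ.tail d) (Γ.tail d') l →
      p (K.left d) = p (K.left d') := by
    intro l
    induction l with
    | nil => exact fun d d' h => hcyc _ _ (K.rot_sameCycle _ _ h)
    | cons a l ih =>
      intro d d' h
      rw [hcyc d a (K.rot_sameCycle _ _ h.1.symm), ← hrev a]
      exact ih _ _ h.2
  obtain ⟨d, rfl⟩ := Quotient.exists_rep f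
  obtain ⟨d', rfl⟩ := Quotient.exists_rep g
  obtain ⟨l, hl⟩ := hΓ.2 (Γ.tail d) (Γ.tail d')
  exact hwalk l d d' hl

end RotationSystem

/-! ### Exactness by dimension count. -/

section LinearAlgebra

theorem finrank_ker_le_one {X E : Type*} [Fintype X] (N : Matrix E X ℝ) (u : X → ℝ)
    (h : ∀ x, N *ᵥ x = 0 → ∃ t : ℝ, x = t • u) :
    Module.finrank ℝ (LinearMap.ker N.mulVecLin) ≤ 1 := by
  have : LinearMap.ker N.mulVecLin ≤ Submodule.span ℝ {u} := fun x hx => by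
    obtain ⟨t, rfl⟩ := h x hx
    exact Submodule.smul_mem _ _ (Submodule.mem_span_singleton_self u)
  refine (Submodule.finrank_mono this).trans ((finrank_span_le_card {u}).trans ?_)
  simp

/-- Exactness of a sequence `ℝ^Y → ℝ^E → ℝ^X` by counting dimensions. -/
theorem exists_mulVec_eq_of_finrank {X Y E : Type*} [Fintype X] [Fintype Y] [Fintype E]
    (N : Matrix E X ℝ) (P : Matrix E Y ℝ) (hNP : Nᵀ * P = 0)
    (hN : Module.finrank ℝ (LinearMap.ker N.mulVecLin) ≤ 1)
    (hP : Module.finrank ℝ (LinearMap.ker P.mulVecLin) ≤ 1)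
    (hcard : Fintype.card X + Fintype.card Y = Fintype.card E + 2)
    (φ : E → ℝ) (hφ : Nᵀ *ᵥ φ = 0) : ∃ p, P *ᵥ p = φ := by
  classical
  have h1 := N.mulVecLin.finrank_range_add_finrank_ker
  have h2 := P.mulVecLin.finrank_range_add_finrank_ker
  have h3 := Nᵀ.mulVecLin.finrank_range_add_finrank_ker
  have h4 : Module.finrank ℝ (LinearMap.range Nᵀ.mulVecLin)
      = Module.finrank ℝ (LinearMap.range N.mulVecLin) := N.rank_transpose
  rw [Module.finrank_fintype_fun_eq_card] at h1 h2 h3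
  have hle : LinearMap.range P.mulVecLin ≤ LinearMap.ker Nᵀ.mulVecLin := by
    rintro _ ⟨y, rfl⟩
    rw [LinearMap.mem_ker, Matrix.mulVecLin_apply, Matrix.mulVecLin_apply, Matrix.mulVec_mulVec, hNP,
      Matrix.zero_mulVec]
  -- The dimension of `ker Nᵀ` is `|E| - rank N ≤ |E| - |X| + 1 = |Y| - 1 ≤ rank P`.
  have heq := Submodule.eq_of_le_of_finrank_le hle (by omega)
  have : φ ∈ LinearMap.ker Nᵀ.mulVecLin := hφ
  rw [← heq] at this
  exact this

end LinearAlgebra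

/-! ### Homology of the embedded graph and its dual. -/

namespace TorusEmbedding

variable {V E : Type*} [Fintype V] [Fintype E] {Γ : MultiGraph V E} (K : TorusEmbedding Γ)

theorem corner_faceNext_real (i : Fin 2) (d : Dart E) :
    (K.corner (K.faceNext d) i : ℝ)
      = K.corner d i + onDarts (fun e => (K.hom e i : ℝ)) d := by
  rw [K.corner_faceNext]
  rcases d with ⟨e, _ | _⟩ <;> simp [onDarts]

theorem sum_dual_coboundary_mul_hom (p : K.Face → ℝ) (i : Fin 2) :
    ∑ e, (p (K.left (e, true)) - p (K.right (e, true))) * (K.hom e i : ℝ) = 0 :=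
  K.sum_dual_coboundary_mul_eq_zero p _ (fun d => (K.corner d i : ℝ)) (K.corner_faceNext_real i)

theorem onDarts_dualHom (i : Fin 2) (d : Dart E) :
    onDarts (fun e => (K.dualHom e i : ℝ)) d
      = K.corner (revDart E d) i - onDarts (fun e => (K.hom e i : ℝ)) d - K.corner d i := by
  rcases d with ⟨e, _ | _⟩ <;> simp [onDarts, dualHom, revDart]; ring

/-- On a dart `d`, `dualHom` equals `corner (rot⁻¹ d) - corner d`, so it telescopes around every
vertex: the dual edges around a vertex bound a contractible disc. -/
theorem sum_coboundary_mul_dualHom (q : V → ℝ) (i : Fin 2) :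
    ∑ e, (q (Γ.tgt e) - q (Γ.src e)) * (K.dualHom e i : ℝ) = 0 := by
  rw [MultiGraph.sum_coboundary_mul, neg_eq_zero]
  have h : ∀ d, q (Γ.tail d) * onDarts (fun e => (K.dualHom e i : ℝ)) d
      = q (Γ.tail (K.rot.symm d)) * K.corner (K.rot.symm d) i
        - q (Γ.tail d) * K.corner d i := fun d => by
    rw [onDarts_dualHom, K.tail_rot_symm, ← K.faceNext_rev, corner_faceNext_real, onDarts_rev]
    ring
  rw [Finset.sum_congr rfl fun d _ => h d, Finset.sum_sub_distrib,
    Equiv.sum_comp K.rot.symm (fun d => q (Γ.tail d) * (K.corner d i : ℝ)), sub_self]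

/-- The intersection pairing of the graph with its dual, in the homology of the torus. -/
theorem sum_dualHom_mul_hom (i j : Fin 2) :
    ∑ e, (K.dualHom e i : ℝ) * K.hom e j = !![(0 : ℝ), -1; 1, 0] i j := by
  -- Summing over darts doubles the pairing. Reindexing by `revDart` and `faceNext` turns it into
  -- minus a sum of cross products of consecutive corners; for `i ≠ j` this is, up to sign, twice
  -- the total signed area of the lifted faces, which `degree_one` evaluates.
  have key : 2 * ∑ e, (K.dualHom e i : ℝ) * K.hom e j
      = -∑ d, ((K.corner d i : ℝ) * K.corner (K.faceNext d) j
          - K.corner d j * K.corner (K.faceNext d) i) := by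
    rw [← sum_onDarts_mul_onDarts (fun e => (K.dualHom e i : ℝ))]
    have hrev : ∑ d, (K.corner (revDart E d) i : ℝ) * onDarts (fun e => (K.hom e j : ℝ)) d
        = -∑ d, (K.corner d i : ℝ) * onDarts (fun e => (K.hom e j : ℝ)) d := by
      rw [← Equiv.sum_comp (revDart E), ← Finset.sum_neg_distrib]
      refine Finset.sum_congr rfl fun d _ => ?_
      rw [onDarts_rev]
      rcases d with ⟨e, b⟩
      simp [revDart]
    have hnext := Equiv.sum_comp K.faceNext
      (fun d => (K.corner d i : ℝ) * (K.corner d j : ℝ))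
    simp only [onDarts_dualHom, sub_mul, Finset.sum_sub_distrib, hrev]
    simp only [K.corner_faceNext_real, mul_add, add_mul, Finset.sum_add_distrib] at hnext ⊢
    have hc : ∑ d, (K.corner d j : ℝ) * (K.corner d i : ℝ)
        = ∑ d, (K.corner d i : ℝ) * (K.corner d j : ℝ) :=
      Finset.sum_congr rfl fun d _ => mul_comm _ _
    have hc' : ∑ d, (K.corner d j : ℝ) * onDarts (fun e => (K.hom e i : ℝ)) d
        = ∑ d, onDarts (fun e => (K.hom e i : ℝ)) d * (K.corner d j : ℝ) :=
      Finset.sum_congr rfl fun d _ => mul_comm _ _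
    rw [hc, hc']
    linarith
  have hdeg : ∑ d, ((K.corner d 0 : ℝ) * K.corner (K.faceNext d) 1
      - K.corner d 1 * K.corner (K.faceNext d) 0) = 2 := by
    have := congrArg (Int.cast : ℤ → ℝ) K.degree_one
    simpa [cross] using this
  have hneg : ∑ d, ((K.corner d 1 : ℝ) * K.corner (K.faceNext d) 0
      - K.corner d 0 * K.corner (K.faceNext d) 1) = -2 := by
    rw [← hdeg, ← Finset.sum_neg_distrib]
    exact Finset.sum_congr rfl fun d _ => by ring
  fin_cases i <;> fin_cases j
  · simpa using key
  · change 2 * ∑ e, (K.dualHom e 0 : ℝ) * K.hom e 1 = -∑ d, _ at key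
    change ∑ e, (K.dualHom e 0 : ℝ) * K.hom e 1 = -1
    linarith [key.trans (congrArg Neg.neg hdeg)]
  · change 2 * ∑ e, (K.dualHom e 1 : ℝ) * K.hom e 0 = -∑ d, _ at key
    change ∑ e, (K.dualHom e 1 : ℝ) * K.hom e 0 = 1
    linarith [key.trans (congrArg Neg.neg hneg)]
  · simpa using key

/-- A closed cochain of the dual graph that pairs to zero with the homology vectors of the graph
is a coboundary. -/
theorem exists_dual_potential (φ : E → ℝ)
    (hq : ∀ q : V → ℝ, ∑ e, (q (Γ.tgt e) - q (Γ.src e)) * φ e = 0)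
    (hh : ∀ i, ∑ e, (K.hom e i : ℝ) * φ e = 0) :
    ∃ p : K.Face → ℝ, ∀ e, φ e = p (K.left (e, true)) - p (K.right (e, true)) := by
  classical
  have : Finite K.Face := Quotient.finite _
  have := Fintype.ofFinite K.Face
  -- The image of `N` is spanned by the primal coboundaries and the two homology coordinates; the
  -- image of `P` consists of the dual coboundaries.
  let N : Matrix E (V ⊕ Fin 2) ℝ := Matrix.of fun e => Sum.elim
    (fun v => (if Γ.tgt e = v then 1 else 0) - (if Γ.src e = v then 1 else 0))
    (fun i => (K.hom e i : ℝ))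
  let P : Matrix E K.Face ℝ := Matrix.of fun e f =>
    (if K.left (e, true) = f then 1 else 0) - (if K.right (e, true) = f then 1 else 0)
  have hP : ∀ p e, (P *ᵥ p) e = p (K.left (e, true)) - p (K.right (e, true)) := fun p e => by
    simp [P, Matrix.mulVec, dotProduct, sub_mul]
  have hN : ∀ x e, (N *ᵥ x) e = (x (.inl (Γ.tgt e)) - x (.inl (Γ.src e)))
      + ∑ i, (K.hom e i : ℝ) * x (.inr i) := fun x e => by
    simp [N, Matrix.mulVec, dotProduct, sub_mul]
  have hNt : ∀ ψ : E → ℝ, (∀ q : V → ℝ, ∑ e, (q (Γ.tgt e) - q (Γ.src e)) * ψ e = 0) →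
      (∀ i, ∑ e, (K.hom e i : ℝ) * ψ e = 0) → Nᵀ *ᵥ ψ = 0 := by
    intro ψ h1 h2
    funext x
    rcases x with v | i
    · have := h1 (Pi.single v 1)
      simpa [N, Matrix.mulVec, dotProduct, Pi.single_apply] using this
    · simpa [N, Matrix.mulVec, dotProduct] using h2 i
  have hNP : Nᵀ * P = 0 := by
    refine Matrix.ext_of_mulVec_single fun f => ?_
    rw [← Matrix.mulVec_mulVec, Matrix.zero_mulVec]
    refine hNt _ (fun q => ?_) (fun i => ?_)
    · simp only [hP]
      rw [← K.sum_dual_coboundary_mul_coboundary (Pi.single f 1) q]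
      exact Finset.sum_congr rfl fun e _ => mul_comm _ _
    · simp only [hP]
      rw [← K.sum_dual_coboundary_mul_hom (Pi.single f 1) i]
      exact Finset.sum_congr rfl fun e _ => mul_comm _ _
  have hNker : Module.finrank ℝ (LinearMap.ker N.mulVecLin) ≤ 1 := by
    refine finrank_ker_le_one N (Sum.elim 1 0) fun x hx => ?_
    have hx' : ∀ e, (x (.inl (Γ.tgt e)) - x (.inl (Γ.src e)))
        + ∑ i, (K.hom e i : ℝ) * x (.inr i) = 0 := fun e => by rw [← hN, hx]; rfl
    -- Pairing the relation with `dualHom` kills its coboundary part. The intersection form is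
    -- nondegenerate, so both homology coefficients vanish; connectedness then leaves only
    -- constants.
    have hpair : ∀ i, ∑ j, !![(0 : ℝ), -1; 1, 0] i j * x (.inr j) = 0 := fun i => by
      have h1 : ∑ e, ((x (.inl (Γ.tgt e)) - x (.inl (Γ.src e)))
          + ∑ j, (K.hom e j : ℝ) * x (.inr j)) * (K.dualHom e i : ℝ) = 0 :=
        Finset.sum_eq_zero fun e _ => by rw [hx', zero_mul]
      simp only [add_mul, Finset.sum_add_distrib] at h1
      rw [K.sum_coboundary_mul_dualHom (fun v => x (.inl v)), zero_add] at h1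
      simp only [Finset.sum_mul] at h1
      rw [Finset.sum_comm] at h1
      refine Eq.trans ?_ h1
      refine Finset.sum_congr rfl fun j _ => ?_
      rw [← K.sum_dualHom_mul_hom i j, Finset.sum_mul]
      exact Finset.sum_congr rfl fun e _ => by ring
    have h0 : x (.inr 0) = 0 := by simpa using hpair 1
    have h1 : x (.inr 1) = 0 := by simpa using hpair 0
    obtain ⟨v₀⟩ := K.connected.1
    refine ⟨x (.inl v₀), ?_⟩
    funext y
    rcases y with v | i
    · simp only [Pi.smul_apply, Sum.elim_inl, Pi.one_apply, smul_eq_mul, mul_one]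
      refine K.connected.eq_of_coboundary_eq_zero (fun v => x (.inl v)) (fun e => ?_) v v₀
      have := hx' e
      simp only [Fin.sum_univ_two, h0, h1] at this
      linarith
    · fin_cases i <;> simp [h0, h1]
  have hPker : Module.finrank ℝ (LinearMap.ker P.mulVecLin) ≤ 1 := by
    refine finrank_ker_le_one P 1 fun p hp => ?_
    rcases isEmpty_or_nonempty K.Face with hF | ⟨⟨f₀⟩⟩
    · exact ⟨0, Subsingleton.elim _ _⟩
    · refine ⟨p f₀, funext fun f => ?_⟩
      simp only [Pi.smul_apply, Pi.one_apply, smul_eq_mul, mul_one]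
      refine K.eq_of_dual_coboundary_eq_zero K.connected p (fun e => ?_) f f₀
      rw [← sub_eq_zero, ← hP, hp]; rfl
  -- Euler characteristic `0`; the `2` accounts for the homology columns of `N`.
  have hcard : Fintype.card (V ⊕ Fin 2) + Fintype.card K.Face = Fintype.card E + 2 := by
    have := K.euler
    simp only [Nat.card_eq_fintype_card] at this
    simp only [Fintype.card_sum, Fintype.card_fin]
    omega
  obtain ⟨p, hp⟩ := exists_mulVec_eq_of_finrank N P hNP hNker hPker hcard φ (hNt φ hq hh)
  exact ⟨p, fun e => by rw [← hp, hP]⟩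

end TorusEmbedding

/-! ### Equilibrium stresses under linear maps and in homology. -/

namespace GeodesicDrawing

variable {V E : Type*} {Γ : MultiGraph V E} {M : Matrix (Fin 2) (Fin 2) ℝ}

/-- Equilibrium in weak form: summation by parts collects the stressed displacements at each vertex,
where they cancel. -/
theorem IsEquilibriumStress.sum_coboundary_mul [Fintype V] [Fintype E] {G : GeodesicDrawing Γ M}
    {ω : E → ℝ} (hω : G.IsEquilibriumStress ω) (q : V → ℝ) (i : Fin 2) :
    ∑ e, (q (Γ.tgt e) - q (Γ.src e)) * (ω e * G.disp e i) = 0 := by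
  classical
  rw [MultiGraph.sum_coboundary_mul, neg_eq_zero]
  have h : ∀ d, q (Γ.tail d) * onDarts (fun e => ω e * G.disp e i) d
      = ∑ v, q v * (if Γ.tail d = v then ω d.1 • onDarts G.disp d else 0) i := fun d => by
    rw [Finset.sum_eq_single (Γ.tail d) (fun v _ hv => by simp [hv.symm]) (by simp)]
    rcases d with ⟨e, _ | _⟩ <;> simp [onDarts]
  rw [Finset.sum_congr rfl fun d _ => h d, Finset.sum_comm]
  refine Finset.sum_eq_zero fun v _ => ?_
  have := congrFun (hω v) i
  rw [Pi.zero_apply, Finset.sum_apply] at this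
  rw [← Finset.mul_sum]
  refine mul_eq_zero_of_right _ (Eq.trans ?_ this)
  exact Finset.sum_congr rfl fun d _ => by split_ifs <;> rfl

theorem image_disp (G : GeodesicDrawing Γ 1) (M : Matrix (Fin 2) (Fin 2) ℝ) (e : E) :
    (G.image M).disp e = M *ᵥ G.disp e := by
  simp [disp, image, Matrix.mulVec_add, Matrix.mulVec_sub]

theorem IsEquilibriumStress.image [Fintype E] {G : GeodesicDrawing Γ 1} {ω : E → ℝ}
    (hω : G.IsEquilibriumStress ω) (M : Matrix (Fin 2) (Fin 2) ℝ) :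
    (G.image M).IsEquilibriumStress ω := by
  classical
  intro v
  have h := congrArg (fun x => M.mulVecLin x) (hω v)
  simp only [map_sum, map_zero] at h
  refine Eq.trans (Finset.sum_congr rfl fun d _ => ?_) h
  split_ifs
  · rw [map_smul]
    congr 1
    have : (G.image M).disp = fun e => M.mulVecLin.toAddMonoidHom (G.disp e) :=
      funext fun e => image_disp G M e
    rw [this, onDarts_comp]
    rfl
  · simp

/-- In the stress matrix, one of the two displacements can be replaced by the homology vector. -/
theorem sum_disp_mul_hom [Fintype V] [Fintype E] {K : TorusEmbedding Γ} {G : GeodesicDrawing Γ 1}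
    (hG : G.HomotopicTo K) {ω : E → ℝ} (hω : G.IsEquilibriumStress ω) (i j : Fin 2) :
    ∑ e, ω e * G.disp e i * K.hom e j = ∑ e, ω e * (G.disp e i * G.disp e j) := by
  obtain ⟨q, hq⟩ := MultiGraph.Homotopic.exists_potential hG
  -- The coboundary of this function is exactly `disp - K.hom` in coordinate `j`: `pos` gives the
  -- geometric part and `q` the change of homology representative.
  have h := hω.sum_coboundary_mul (fun v => G.pos v j + (q v j : ℝ)) i
  rw [eq_comm, ← sub_eq_zero, ← Finset.sum_sub_distrib, ← h]
  refine Finset.sum_congr rfl fun e _ => ?_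
  have : G.disp e j = G.pos (Γ.tgt e) j - G.pos (Γ.src e) j + (K.hom e j
      + ((q (Γ.tgt e) j : ℝ) - q (Γ.src e) j)) := by
    simp [disp, hq e]
  rw [this]; ring

end GeodesicDrawing

/-- The counterclockwise quarter turn of the plane. -/
def quarterTurn : Matrix (Fin 2) (Fin 2) ℝ := !![0, -1; 1, 0]

/-- By Lagrange's identity, orthogonality and the lengths give `(t * cross v w)² = (t²|v|²)²`. The
sign condition selects the positive root, and then `|w - t J v|² = |w|² - 2 t cross v w + t²|v|² =
0`. Zero edges and zero stresses need no separate treatment. -/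
theorem orthogonal_and_length_iff (v w : Fin 2 → ℝ) (t : ℝ) :
    (v ⬝ᵥ w = 0 ∧ euclideanLength w = |t| * euclideanLength v ∧ 0 ≤ t * cross v w)
      ↔ w = t • (quarterTurn *ᵥ v) := by
  have hJ : w = t • (quarterTurn *ᵥ v) ↔ w 0 = -(t * v 1) ∧ w 1 = t * v 0 := by
    rw [funext_iff, Fin.forall_fin_two]
    simp [quarterTurn, dotProduct, Fin.sum_univ_two]
  have hlen : ∀ u : Fin 2 → ℝ, euclideanLength u = √(u 0 ^ 2 + u 1 ^ 2) := fun u => by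
    simp [euclideanLength, dotProduct, Fin.sum_univ_two, sq]
  rw [hJ, hlen, hlen, cross]
  simp only [dotProduct, Fin.sum_univ_two]
  constructor
  · rintro ⟨h1, h2, h3⟩
    have h4 : w 0 ^ 2 + w 1 ^ 2 = t ^ 2 * (v 0 ^ 2 + v 1 ^ 2) := by
      have := congrArg (· ^ 2) h2
      simpa [mul_pow, Real.sq_sqrt, add_nonneg, sq_nonneg] using this
    have h5 : (t * (v 0 * w 1 - v 1 * w 0)) ^ 2 = (t ^ 2 * (v 0 ^ 2 + v 1 ^ 2)) ^ 2 := by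
      linear_combination t ^ 2 * (v 0 ^ 2 + v 1 ^ 2) * h4
        - t ^ 2 * (v 0 * w 0 + v 1 * w 1) * h1
    have h6 := (sq_eq_sq₀ h3 (by positivity)).1 h5
    have h7 : (w 0 + t * v 1) ^ 2 + (w 1 - t * v 0) ^ 2 = 0 := by
      linear_combination h4 - 2 * h6
    constructor
    · nlinarith [sq_nonneg (w 0 + t * v 1), sq_nonneg (w 1 - t * v 0)]
    · nlinarith [sq_nonneg (w 0 + t * v 1), sq_nonneg (w 1 - t * v 0)]
  · rintro ⟨h1, h2⟩
    rw [h1, h2]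
    refine ⟨by ring, ?_, ?_⟩
    · rw [← Real.sqrt_sq_eq_abs, ← Real.sqrt_mul (sq_nonneg t)]
      congr 1; ring
    · have : t * (v 0 * (t * v 0) - v 1 * -(t * v 1)) = t ^ 2 * (v 0 ^ 2 + v 1 ^ 2) := by ring
      rw [this]; positivity

/-! ### Reduction to a matrix equation. -/

namespace GeodesicDrawing

variable {V E : Type*} [Fintype V] [Fintype E] {Γ : MultiGraph V E} {K : TorusEmbedding Γ}
  {G : GeodesicDrawing Γ 1} {ω : E → ℝ}

/-- The symmetric matrix `Δ Ω Δᵀ` of a stress. -/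
def stressMatrix (G : GeodesicDrawing Γ 1) (ω : E → ℝ) : Matrix (Fin 2) (Fin 2) ℝ :=
  Matrix.of fun i j => ∑ e, ω e * (G.disp e i * G.disp e j)

theorem isOrthogonalReciprocalStress_iff_exists_potential (hω : G.IsEquilibriumStress ω)
    (M : Matrix (Fin 2) (Fin 2) ℝ) :
    (G.image M).IsOrthogonalReciprocalStress K ω ↔ ∃ p : K.Face → Fin 2 → ℝ, ∀ e,
      ω e • (quarterTurn *ᵥ M *ᵥ G.disp e)
        = p (K.left (e, true)) - p (K.right (e, true)) + M *ᵥ fun i => (K.dualHom e i : ℝ) := by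
  constructor
  · rintro ⟨-, G', ⟨hhom, hdot⟩, hlen⟩
    obtain ⟨q, hq⟩ := MultiGraph.Homotopic.exists_potential hhom
    -- A homotopy changes the homology vectors by an integral coboundary, which amounts to choosing
    -- other lifts of the dual vertices.
    refine ⟨fun f => G'.pos f + M *ᵥ fun i => (q f i : ℝ), fun e => ?_⟩
    rw [← image_disp, ← (orthogonal_and_length_iff _ _ _).1 ⟨hdot e, hlen e⟩, disp]
    have : (fun i => (G'.hom e i : ℝ)) = (fun i => (K.dualHom e i : ℝ))
        + ((fun i => (q (K.left (e, true)) i : ℝ)) - fun i => (q (K.right (e, true)) i : ℝ)) := by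
      funext i
      simp [hq e, RotationSystem.dual]
    rw [this, Matrix.mulVec_add, Matrix.mulVec_sub]
    change G'.pos (K.left (e, true)) - G'.pos (K.right (e, true)) + _
      = (_ + M *ᵥ fun i => (q (K.left (e, true)) i : ℝ))
        - (_ + M *ᵥ fun i => (q (K.right (e, true)) i : ℝ)) + _
    abel
  · rintro ⟨p, hp⟩
    let G' : GeodesicDrawing K.dual M := ⟨p, K.dualHom⟩
    have h : ∀ e, G'.disp e = ω e • (quarterTurn *ᵥ (G.image M).disp e) := fun e => by
      rw [image_disp, hp]; rfl
    have h' := fun e => (orthogonal_and_length_iff _ _ _).2 (h e)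
    exact ⟨hω.image M, G', ⟨fun _ _ _ => rfl, fun e => (h' e).1⟩, fun e => (h' e).2⟩

theorem isOrthogonalReciprocalStress_iff (hG : G.HomotopicTo K) (hω : G.IsEquilibriumStress ω)
    (M : Matrix (Fin 2) (Fin 2) ℝ) :
    (G.image M).IsOrthogonalReciprocalStress K ω
      ↔ quarterTurn * M * G.stressMatrix ω = M * quarterTurn := by
  rw [isOrthogonalReciprocalStress_iff_exists_potential hω]
  have hφ : ∀ i e, (ω e • (quarterTurn *ᵥ M *ᵥ G.disp e) - M *ᵥ fun k => (K.dualHom e k : ℝ)) i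
      = ∑ k, (quarterTurn * M) i k * (ω e * G.disp e k) - ∑ k, M i k * (K.dualHom e k : ℝ) := by
    intro i e
    rw [Matrix.mulVec_mulVec, Pi.sub_apply, Pi.smul_apply, smul_eq_mul]
    simp only [Matrix.mulVec, dotProduct, Finset.mul_sum]
    congr 1
    exact Finset.sum_congr rfl fun k _ => by ring
  -- Row `i` of the cochain paired with homology coordinate `j` is the `(i, j)` entry of the defect
  -- `J M S - M J`.
  have hpair : ∀ i j, ∑ e, (K.hom e j : ℝ)
      * (ω e • (quarterTurn *ᵥ M *ᵥ G.disp e) - M *ᵥ fun k => (K.dualHom e k : ℝ)) i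
      = (quarterTurn * M * G.stressMatrix ω) i j - (M * quarterTurn) i j := by
    intro i j
    rw [Matrix.mul_apply, Matrix.mul_apply]
    simp only [hφ, mul_sub, Finset.sum_sub_distrib, Finset.mul_sum]
    congr 1
    · rw [Finset.sum_comm]
      refine Finset.sum_congr rfl fun k _ => ?_
      rw [stressMatrix, Matrix.of_apply, ← sum_disp_mul_hom hG hω, Finset.mul_sum]
      exact Finset.sum_congr rfl fun e _ => by ring
    · rw [Finset.sum_comm]
      refine Finset.sum_congr rfl fun k _ => ?_
      rw [quarterTurn, ← K.sum_dualHom_mul_hom, Finset.mul_sum]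
      exact Finset.sum_congr rfl fun e _ => by ring
  constructor
  · rintro ⟨p, hp⟩
    ext i j
    rw [← sub_eq_zero, ← hpair, ← K.sum_dual_coboundary_mul_hom (fun f => p f i) j]
    refine Finset.sum_congr rfl fun e _ => ?_
    rw [hp, add_sub_cancel_right, mul_comm]
    rfl
  · intro h
    have hex : ∀ i, ∃ p : K.Face → ℝ, ∀ e,
        (ω e • (quarterTurn *ᵥ M *ᵥ G.disp e) - M *ᵥ fun k => (K.dualHom e k : ℝ)) i
          = p (K.left (e, true)) - p (K.right (e, true)) := by
      intro i
      refine K.exists_dual_potential _ (fun q => ?_) (fun j => by rw [hpair, h, sub_self])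
      simp only [hφ, mul_sub, Finset.sum_sub_distrib, Finset.mul_sum]
      rw [sub_eq_zero, Finset.sum_comm, Finset.sum_comm (γ := E)]
      refine Finset.sum_congr rfl fun k _ => ?_
      have h1 := congrArg ((quarterTurn * M) i k * ·) (hω.sum_coboundary_mul q k)
      have h2 := congrArg (M i k * ·) (K.sum_coboundary_mul_dualHom q k)
      simp only [mul_zero, Finset.mul_sum] at h1 h2
      refine (Eq.trans ?_ h1).trans (Eq.trans ?_ h2).symm <;>
        exact Finset.sum_congr rfl fun e _ => by ring
    choose p hp using hex
    refine ⟨fun f i => p i f, fun e => ?_⟩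
    rw [← sub_eq_iff_eq_add]
    exact funext fun i => hp i e

end GeodesicDrawing

/-! ### Solving the matrix equation. -/

theorem det_eq_one_of_quarterTurn_mul_mul {M S : Matrix (Fin 2) (Fin 2) ℝ} (hM : M.det ≠ 0)
    (h : quarterTurn * M * S = M * quarterTurn) : S.det = 1 := by
  have := congrArg Matrix.det h
  have hJ : quarterTurn.det = 1 := by simp [quarterTurn, Matrix.det_fin_two]
  rw [Matrix.det_mul, Matrix.det_mul, Matrix.det_mul, hJ, one_mul, mul_one] at this
  exact mul_left_cancel₀ hM (this.trans (mul_one _).symm)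

theorem mem_specialOrthogonalGroup_fin_two (a b : ℝ) (h : a ^ 2 + b ^ 2 = 1) :
    !![a, -b; b, a] ∈ Matrix.specialOrthogonalGroup (Fin 2) ℝ := by
  rw [Matrix.mem_specialOrthogonalGroup_iff, Matrix.mem_orthogonalGroup_iff]
  constructor
  · ext i j
    fin_cases i <;> fin_cases j <;>
      simp [Matrix.mul_apply, Fin.sum_univ_two] <;> linarith
  · rw [Matrix.det_fin_two_of]; linarith

theorem quarterTurn_mul_comm_of_mem {R : Matrix (Fin 2) (Fin 2) ℝ}
    (hR : R ∈ Matrix.specialOrthogonalGroup (Fin 2) ℝ) :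
    quarterTurn * R = R * quarterTurn := by
  rw [Matrix.mem_specialOrthogonalGroup_iff, Matrix.mem_orthogonalGroup_iff] at hR
  obtain ⟨h1, h2⟩ := hR
  have h00 := congrFun (congrFun h1 0) 0
  have h01 := congrFun (congrFun h1 0) 1
  have h11 := congrFun (congrFun h1 1) 1
  rw [Matrix.det_fin_two] at h2
  simp [Matrix.mul_apply, Fin.sum_univ_two] at h00 h01 h11
  have h3 : (R 0 0 - R 1 1) ^ 2 + (R 0 1 + R 1 0) ^ 2 = 0 := by
    linear_combination h00 + h11 - 2 * h2
  have h4 : R 0 0 = R 1 1 := by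
    nlinarith [sq_nonneg (R 0 0 - R 1 1), sq_nonneg (R 0 1 + R 1 0)]
  have h5 : R 0 1 = -R 1 0 := by
    nlinarith [sq_nonneg (R 0 0 - R 1 1), sq_nonneg (R 0 1 + R 1 0)]
  ext i j
  fin_cases i <;> fin_cases j <;>
    simp [quarterTurn, Matrix.mul_apply, Fin.sum_univ_two, h4, h5]

theorem quarterTurn_mul_mul_iff {α β γ : ℝ} (h1 : α * β - γ ^ 2 = 1)
    (M : Matrix (Fin 2) (Fin 2) ℝ) :
    (M.det ≠ 0 ∧ quarterTurn * M * !![α, γ; γ, β] = M * quarterTurn) ↔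
      ∃ R ∈ Matrix.specialOrthogonalGroup (Fin 2) ℝ, ∃ σ : ℝ, 0 < σ ∧
        M = σ • (R * !![β, -γ; 0, 1]) := by
  -- Because `α * β = 1 + γ ^ 2 > 0`.
  have hβ : β ≠ 0 := by
    rintro rfl
    nlinarith [sq_nonneg γ]
  constructor
  · rintro ⟨hdet, h⟩
    have h00 := congrFun (congrFun h 0) 0
    have h01 := congrFun (congrFun h 0) 1
    have h10 := congrFun (congrFun h 1) 0
    have h11 := congrFun (congrFun h 1) 1
    simp [quarterTurn, Matrix.mul_apply, Matrix.vecMul, dotProduct, Fin.sum_univ_two]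
      at h00 h01 h10 h11
    -- The first column defines `a` and `b`; the second column of the equation then gives `M = !![a,
    -- -b; b, a] * !![β, -γ; 0, 1]`. Dividing by `√(a² + b²)` leaves the rotation.
    obtain ⟨a, e00⟩ : ∃ a, M 0 0 = a * β := ⟨M 0 0 / β, by field_simp⟩
    obtain ⟨b, e10⟩ : ∃ b, M 1 0 = b * β := ⟨M 1 0 / β, by field_simp⟩
    have e01 : M 0 1 = -a * γ - b := by
      apply mul_left_cancel₀ hβ
      linear_combination h11 - γ * e00 - e10
    have e11 : M 1 1 = -b * γ + a := by
      apply mul_left_cancel₀ hβ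
      linear_combination -h01 - γ * e10 + e00
    have hab : 0 < a ^ 2 + b ^ 2 := by
      by_contra hn
      have ha0 : a = 0 := by nlinarith [sq_nonneg a, sq_nonneg b]
      have hb0 : b = 0 := by nlinarith [sq_nonneg a, sq_nonneg b]
      apply hdet
      rw [Matrix.det_fin_two, e00, e01, e10, e11, ha0, hb0]; ring
    have hσ := Real.sqrt_pos.2 hab
    have hσ2 := Real.sq_sqrt hab.le
    set σ := √(a ^ 2 + b ^ 2)
    refine ⟨_, mem_specialOrthogonalGroup_fin_two (a / σ) (b / σ) ?_, σ, hσ, ?_⟩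
    · rw [div_pow, div_pow, ← add_div, hσ2, div_self hab.ne']
    · ext i j
      fin_cases i <;> fin_cases j <;>
        (simp [e00, e01, e10, e11]; field_simp; try ring)
  · rintro ⟨R, hR, σ, hσ, rfl⟩
    have hcomm := quarterTurn_mul_comm_of_mem hR
    rw [Matrix.mem_specialOrthogonalGroup_iff] at hR
    constructor
    · rw [Matrix.det_smul, Matrix.det_mul, hR.2, Matrix.det_fin_two_of]
      simp [hσ.ne', hβ]
    -- Scalars and rotations commute with `J`, so only `M = !![β, -γ; 0, 1]` has to be checked.
    · rw [mul_smul_comm, smul_mul_assoc, smul_mul_assoc, ← mul_assoc, hcomm, mul_assoc, mul_assoc,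
        mul_assoc]
      congr 2
      ext i j
      fin_cases i <;> fin_cases j <;>
        simp [quarterTurn, Matrix.mul_apply, Fin.sum_univ_two] <;> linarith

theorem theoremT {V E : Type*} [Fintype V] [Fintype E] (Γ : MultiGraph V E)
    (K : TorusEmbedding Γ) (G : GeodesicDrawing Γ 1) (hG : G.HomotopicTo K)
    (ω : E → ℝ) (hω : G.IsEquilibriumStress ω) (α β γ : ℝ)
    (hα : α = ∑ e, ω e * G.dispMatrix 0 e ^ 2)
    (hβ : β = ∑ e, ω e * G.dispMatrix 1 e ^ 2)
    (hγ : γ = ∑ e, ω e * (G.dispMatrix 0 e * G.dispMatrix 1 e)) :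
    (α * β - γ ^ 2 = 1 → ∀ M : Matrix (Fin 2) (Fin 2) ℝ,
      (M.det ≠ 0 ∧ (G.image M).IsOrthogonalReciprocalStress K ω) ↔
        ∃ R ∈ Matrix.specialOrthogonalGroup (Fin 2) ℝ, ∃ σ : ℝ, 0 < σ ∧
          M = σ • (R * !![β, -γ; 0, 1])) ∧
    (α * β - γ ^ 2 ≠ 1 → ∀ M : Matrix (Fin 2) (Fin 2) ℝ, M.det ≠ 0 →
      ¬ (G.image M).IsOrthogonalReciprocalStress K ω) := by
  have hS : G.stressMatrix ω = !![α, γ; γ, β] := by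
    ext i j
    rw [GeodesicDrawing.stressMatrix, Matrix.of_apply]
    fin_cases i <;> fin_cases j
    · simp [hα, GeodesicDrawing.dispMatrix, sq]
    · simp [hγ, GeodesicDrawing.dispMatrix]
    · simp [hγ, GeodesicDrawing.dispMatrix, mul_comm]
    · simp [hβ, GeodesicDrawing.dispMatrix, sq]
  simp only [GeodesicDrawing.isOrthogonalReciprocalStress_iff hG hω, hS]
  refine ⟨fun h M => quarterTurn_mul_mul_iff h M, fun h M hM hrec => h ?_⟩
  have := det_eq_one_of_quarterTurn_mul_mul hM hrec
  rw [Matrix.det_fin_two_of] at this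
  linarith
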